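/- Let $\ell$ and $p$ be distinct primes. Let $X$ be a connected finite multigraph (loops and parallel edges allowed) with vertex set $V_X$, directed edges $\vec{E}_X$, undirected edges $E_X$ and incidence function $\mathrm{inc}:\vec{E}_X\to V_X\times V_X$, $e\mapsto(\text{origin},\text{terminus})$. Assume that $X$ has no vertex of valency one and that $\chi(X)=|V_X|-|E_X|\neq 0$. Let $S\subseteq\vec{E}_X$ be the image of a section of the natural map $\vec{E}_X\to E_X$, let $\alpha:S\to\mathbb{Z}_\ell$ be a function, extended to $\vec{E}_X$ by $\alpha(\bar e)=-\alpha(e)$, where $\bar e$ is the inverse of $e$, and let $\alpha_n$ be its reduction modulo $\ell^n$. Let $X_n=X(\mathbb{Z}/\ell^n\mathbb{Z},S,\alpha_n)$ be the derived multigraph: its vertex set is $V_X\times\mathbb{Z}/\ell^n\mathbb{Z}$, its directed edges are the pairs $(e,a)\in\vec{E}_X\times\mathbb{Z}/\ell^n\mathbb{Z}$, and if $\mathrm{inc}(e)=(x,y)$, then $(e,a)$ goes from $(x,a)$ to $(y,a+\alpha_n(e))$ and has inverse $(\bar e,a+\alpha_n(e))$. Assume that $X_n$ is connected for every $n$. Let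 $\kappa_X$ and $\kappa_n$ be the numbers of spanning trees of $X$ and of $X_n$. For a commutative ring $R$, let $R[T;\mathbb{Z}_\ell]$ be the group ring of $\mathbb{Z}_\ell$ over $R$, whose elements are written as finite sums $P(T)=\sum_{a\in\mathbb{Z}_\ell}\lambda_aT^a$, and put $\mu_{\ell^\infty}(R)=\{\xi\in R^\times:\xi^{\ell^n}=1\text{ for some }n\ge 0\}$. For $\xi$ in $\mu_{\ell^\infty}$ of an $R$-algebra, put $P(\xi)=\sum_a\lambda_a\xi^a$, where $\xi^a=\xi^m$ for any integer $m\equiv a \pmod{\ell^n}$ with $\xi^{\ell^n}=1$. For $P\in\mathbb{Z}[T;\mathbb{Z}_\ell]$ let $\mu(P)=\min_a\mathrm{ord}_p(\lambda_a)$ and let $\bar P\in\mathbb{F}_p[T;\mathbb{Z}_\ell]$ be the reduction of $P$ modulo $p$. Let $D$ be the diagonal matrix of the valencies of the vertices $v_1,\dots,v_r$ of $X$, and put $$M(T)=D-\Big(\sum_{\substack{s\in S\\ \mathrm{inc}(s)=(v_i,v_j)}}T^{\alpha(s)}+\sum_{\substack{s\in S\\ \mathrm{inc}(s)=(v_j,v_i)}}T^{-\alpha(s)}\Big)_{i,j},\qquad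 f(T)=\det M(T)\in\mathbb{Z}[T;\mathbb{Z}_\ell].$$ Let $\mu=\mu(f)$ and write $f=p^{\mu}g$ with $g\in\mathbb{Z}[T;\mathbb{Z}_\ell]$ and $\mu(g)=0$. Let $k_\infty$ be the residue field of the valuation ring of the field generated over $\mathbb{Q}_p$ by all roots of unity of $\ell$-power order in $\overline{\mathbb{Q}}_p$. Assume that $\mu=0$. Then $p\nmid\kappa_n$ for all $n\ge 1$ if and only if $p\nmid\kappa_X$ and $\bar g(\xi)\neq 0$ for every $\xi\in\mu_{\ell^\infty}(k_\infty)\smallsetminus\{1\}$. -/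

import Mathlib

noncomputable section

universe u v

/-! ### Multigraphs -/

/-- A multigraph: vertices, directed edges, an incidence function `e ↦ (origin, terminus)`, and a
fixed-point free inversion of the directed edges. Loops and parallel edges are allowed. -/
structure Multigraph where
  /-- The vertices. -/
  V : Type u
  /-- The directed edges. -/
  Dart : Type v
  /-- The incidence function. -/
  inc : Dart → V × V
  /-- The inversion of directed edges. -/
  inv : Dart → Dart
  inv_inv : ∀ e, inv (inv e) = e
  inv_ne : ∀ e, inv e ≠ e
  inc_inv : ∀ e, inc (inv e) = (inc e).swap

namespace Multigraph

/-- Two directed edges are identified if they are equal or inverse to each other. -/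
def edgeSetoid (X : Multigraph.{u, v}) : Setoid X.Dart where
  r e e' := e' = e ∨ e' = X.inv e
  iseqv :=
    { refl := fun _ => Or.inl rfl
      symm := by
        rintro e e' (h | h)
        · exact Or.inl h.symm
        · exact Or.inr (by rw [h, X.inv_inv])
      trans := by
        rintro a b c (h | h) (h' | h')
        · exact Or.inl (h'.trans h)
        · exact Or.inr (by rw [h', h])
        · exact Or.inr (h'.trans h)
        · exact Or.inl (by rw [h', h, X.inv_inv]) }

/-- The undirected edges. -/
def Edge (X : Multigraph.{u, v}) : Type v := Quotient X.edgeSetoid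

/-- The natural map from directed edges to undirected edges. -/
def toEdge (X : Multigraph.{u, v}) (e : X.Dart) : X.Edge := Quotient.mk X.edgeSetoid e

/-- The spanning subgraph with set of undirected edges `F` is connected (and non-empty). -/
def ConnectedOn (X : Multigraph.{u, v}) (F : Set X.Edge) : Prop :=
  Nonempty X.V ∧
    ∀ x y : X.V, Relation.ReflTransGen (fun a b => ∃ e, X.toEdge e ∈ F ∧ X.inc e = (a, b)) x y

/-- The multigraph is connected (and non-empty). -/
def Connected (X : Multigraph.{u, v}) : Prop := X.ConnectedOn Set.univ

/-- A circuit: a non-empty closed path of directed edges that traverses no undirected edge twice. -/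
def IsCircuit (X : Multigraph.{u, v}) (c : List X.Dart) : Prop :=
  c.IsChain (fun e e' => (X.inc e).2 = (X.inc e').1) ∧
    (∃ h : c ≠ [], (X.inc (c.getLast h)).2 = (X.inc (c.head h)).1) ∧
      (c.map X.toEdge).Nodup

/-- The set of undirected edges `F` is (the edge set of) a spanning tree: the spanning subgraph
with edge set `F` is connected and has no circuit. -/
def IsSpanningTree (X : Multigraph.{u, v}) (F : Set X.Edge) : Prop :=
  X.ConnectedOn F ∧ ¬ ∃ c : List X.Dart, X.IsCircuit c ∧ ∀ e ∈ c, X.toEdge e ∈ F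

/-- `κ_X`, the number of spanning trees. -/
def kappa (X : Multigraph.{u, v}) : ℕ := {F : Set X.Edge | X.IsSpanningTree F}.ncard

/-- The valency of a vertex: the number of directed edges that start there. -/
def valency (X : Multigraph.{u, v}) (x : X.V) : ℕ := {e : X.Dart | (X.inc e).1 = x}.ncard

/-- The Euler characteristic `|V| - |E|` of a finite multigraph. -/
def eulerChar (X : Multigraph.{u, v}) : ℤ := (Nat.card X.V : ℤ) - (Nat.card X.Edge : ℤ)

/-- A section `γ` of the natural map from directed edges to undirected edges. -/
structure Sect (X : Multigraph.{u, v}) where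
  /-- The section. -/
  γ : X.Edge → X.Dart
  toEdge_γ : ∀ e, X.toEdge (γ e) = e

variable {X : Multigraph.{u, v}}

/-- The set `S = γ(E_X)`. -/
def Sect.S (σ : X.Sect) : Set X.Dart := Set.range σ.γ

theorem Sect.inv_mem (σ : X.Sect) {e : X.Dart} (h : e ∉ σ.S) : X.inv e ∈ σ.S := by
  have h1 : X.toEdge (σ.γ (X.toEdge e)) = X.toEdge e := σ.toEdge_γ _
  rcases (Quotient.exact h1 : e = _ ∨ e = _) with h2 | h2
  · exact absurd ⟨X.toEdge e, h2.symm⟩ h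
  · exact ⟨X.toEdge e, by rw [h2, X.inv_inv, ← h2]⟩

theorem Sect.not_inv_mem (σ : X.Sect) {e : X.Dart} (h : e ∈ σ.S) : X.inv e ∉ σ.S := by
  rintro ⟨b, hb⟩
  obtain ⟨a, ha⟩ := h
  have h1 : X.toEdge e = X.toEdge (X.inv e) := Quotient.sound (Or.inr rfl)
  have h2 : a = b := by rw [← σ.toEdge_γ a, ← σ.toEdge_γ b, ha, hb, h1]
  exact X.inv_ne e (by rw [← hb, ← h2, ha])

open Classical in
/-- The extension of `α : S → A` to all directed edges by `α(e⁻¹) = -α(e)`. -/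
def Sect.extend (σ : X.Sect) {A : Type*} [AddGroup A] (α : σ.S → A) (e : X.Dart) : A :=
  if h : e ∈ σ.S then α ⟨e, h⟩ else -α ⟨X.inv e, σ.inv_mem h⟩

theorem Sect.extend_inv (σ : X.Sect) {A : Type*} [AddGroup A] (α : σ.S → A) (e : X.Dart) :
    σ.extend α (X.inv e) = -σ.extend α e := by
  by_cases h : e ∈ σ.S
  · have h' := σ.not_inv_mem h
    simp only [extend, h, h', dite_true, dite_false, X.inv_inv]
  · have h' := σ.inv_mem h
    simp only [extend, h, h', dite_true, dite_false, neg_neg]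

/-- The derived multigraph `X(A, S, α)`: vertices `V × A`, and over a directed edge `e` from `x` to
`y` the directed edges `(e, a)` from `(x, a)` to `(y, a + α(e))`. -/
def derived (X : Multigraph.{u, v}) (σ : X.Sect) {A : Type} [AddCommGroup A] (α : σ.S → A) :
    Multigraph.{u, v} where
  V := X.V × A
  Dart := X.Dart × A
  inc e := (((X.inc e.1).1, e.2), ((X.inc e.1).2, e.2 + σ.extend α e.1))
  inv e := (X.inv e.1, e.2 + σ.extend α e.1)
  inv_inv e := by
    ext
    · exact X.inv_inv _
    · simp [σ.extend_inv]
  inv_ne e h := X.inv_ne e.1 (congrArg Prod.fst h)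
  inc_inv e := by
    simp [X.inc_inv, σ.extend_inv]

/-- The `n`-th layer `X(ℤ/ℓⁿℤ, S, α_n)` of the tower attached to `α : S → ℤ_ℓ`. -/
def layer (X : Multigraph.{u, v}) {ℓ : ℕ} [Fact ℓ.Prime] (σ : X.Sect) (α : σ.S → ℤ_[ℓ]) (n : ℕ) :
    Multigraph.{u, v} :=
  X.derived σ (fun s => PadicInt.toZModPow n (α s) : σ.S → ZMod (ℓ ^ n))

open Classical in
/-- The matrix `M(T)` over `ℤ[T; ℤ_ℓ]`, the group ring of `ℤ_ℓ`, in which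
`AddMonoidAlgebra.single a 1` is `T ^ a`. -/
def matrixM (X : Multigraph.{u, v}) [Fintype X.Dart] {ℓ : ℕ} [Fact ℓ.Prime] (σ : X.Sect)
    (α : σ.S → ℤ_[ℓ]) : Matrix X.V X.V (AddMonoidAlgebra ℤ ℤ_[ℓ]) :=
  Matrix.diagonal (fun x => (X.valency x : AddMonoidAlgebra ℤ ℤ_[ℓ])) -
    Matrix.of fun x y =>
      (∑ s : σ.S, if X.inc s = (x, y) then AddMonoidAlgebra.single (α s) 1 else 0) +
        ∑ s : σ.S, if X.inc s = (y, x) then AddMonoidAlgebra.single (-α s) 1 else 0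

/-- `f(T) = det M(T)`. -/
def polyF (X : Multigraph.{u, v}) [Fintype X.V] [DecidableEq X.V] [Fintype X.Dart] {ℓ : ℕ}
    [Fact ℓ.Prime] (σ : X.Sect) (α : σ.S → ℤ_[ℓ]) : AddMonoidAlgebra ℤ ℤ_[ℓ] :=
  (X.matrixM σ α).det

end Multigraph

/-! ### Generalized polynomials -/

/-- `μ(P)`, the minimum of the `p`-adic valuations of the coefficients of `P`, where the valuation
of `0` is `⊤`. -/
def muInv (p : ℕ) {A : Type*} (P : AddMonoidAlgebra ℤ A) : ℕ∞ :=
  ⨅ a : A, emultiplicity (p : ℤ) (P.coeff a)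

/-- Reduction modulo `p` of the coefficients. -/
def reduceMod (p : ℕ) {A : Type*} [AddMonoid A] (P : AddMonoidAlgebra ℤ A) :
    AddMonoidAlgebra (ZMod p) A :=
  AddMonoidAlgebra.mapRingHom A (Int.castRingHom (ZMod p)) P

/-- `μ_{ℓ^∞}(R)`, the units of `ℓ`-power order. -/
def muEllInf (ℓ : ℕ) (R : Type*) [CommRing R] : Set Rˣ := {u | ∃ n : ℕ, u ^ ℓ ^ n = 1}

section Eval

variable {ℓ : ℕ} [Fact ℓ.Prime]

/-- `ξ ^ a` for `ξ` of `ℓ`-power order and an `ℓ`-adic integer `a`: the power `ξ ^ m` for a natural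
number `m ≡ a` modulo `ℓ ^ n`, where `ξ ^ (ℓ ^ n) = 1`. -/
def adicPow {R : Type*} [CommRing R] (ξ : muEllInf ℓ R) (a : ℤ_[ℓ]) : Rˣ :=
  ξ.1 ^ (PadicInt.toZModPow (Classical.choose ξ.2) a).val

/-- The choice of `n` in `adicPow` does not matter. -/
theorem adicPow_eq {R : Type*} [CommRing R] (ξ : muEllInf ℓ R) (a : ℤ_[ℓ]) (n : ℕ)
    (hn : ξ.1 ^ ℓ ^ n = 1) : adicPow ξ a = ξ.1 ^ (PadicInt.toZModPow n a).val := by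
  have key : ∀ i j : ℕ, i ≤ j → ξ.1 ^ ℓ ^ i = 1 →
      ξ.1 ^ (PadicInt.toZModPow j a).val = ξ.1 ^ (PadicInt.toZModPow i a).val := by
    intro i j hij hi
    have h1 : (PadicInt.toZModPow i a).val = (PadicInt.toZModPow j a).val % ℓ ^ i := by
      rw [← PadicInt.cast_toZModPow i j hij a, ZMod.cast_eq_val, ZMod.val_natCast]
    rw [h1, pow_eq_pow_iff_modEq]
    exact ((Nat.mod_modEq _ _).symm).of_dvd (orderOf_dvd_of_pow_eq_one hi)
  have hm := Classical.choose_spec ξ.2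
  rcases le_total n (Classical.choose ξ.2) with h | h
  · exact key _ _ h hn
  · exact (key _ _ h hm).symm

/-- The value `P(ξ) = ∑ λ_a ξ ^ a` in an `R`-algebra at an element `ξ` of `ℓ`-power order. -/
def genEval {R S : Type*} [CommRing R] [CommRing S] [Algebra R S] (ξ : muEllInf ℓ S)
    (P : AddMonoidAlgebra R ℤ_[ℓ]) : S :=
  P.coeff.sum fun a c => algebraMap R S c * (adicPow ξ a : Sˣ)

end Eval

/-! ### The residue field `k_∞` -/

section Residue

variable (ℓ p : ℕ) [Fact p.Prime]

/-- `ℚ_p(ξ_{ℓ^∞})`, the subfield of an algebraic closure of `ℚ_p` generated over `ℚ_p` by all roots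
of unity of `ℓ`-power order. -/
def cycField : IntermediateField ℚ_[p] (PadicAlgCl p) :=
  IntermediateField.adjoin ℚ_[p] {ξ : PadicAlgCl p | ∃ n : ℕ, ξ ^ ℓ ^ n = 1}

/-- `O_∞`, the valuation ring of `ℚ_p(ξ_{ℓ^∞})` for the restriction of the `p`-adic valuation. -/
def cycRing : ValuationSubring (cycField ℓ p) :=
  ((PadicAlgCl.valued p).v.comap
    (algebraMap (cycField ℓ p) (PadicAlgCl p))).valuationSubring

/-- `k_∞`, the residue field of `O_∞`. -/
abbrev kInf : Type := IsLocalRing.ResidueField (cycRing ℓ p)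

instance kInf_charP : CharP (kInf ℓ p) p := by
  have hp := Fact.out (p := p.Prime)
  rw [CharP.charP_iff_prime_eq_zero hp, ← map_natCast (IsLocalRing.residue (cycRing ℓ p)),
    IsLocalRing.residue_eq_zero_iff, IsLocalRing.mem_maximalIdeal, mem_nonunits_iff]
  rintro ⟨w, hw⟩
  have h1 : (PadicAlgCl.valued p).v (((w⁻¹ : (cycRing ℓ p)ˣ) : cycRing ℓ p) : PadicAlgCl p) ≤ 1 :=
    ((w⁻¹ : (cycRing ℓ p)ˣ) : cycRing ℓ p).2
  have h2 : ((p : cycRing ℓ p) : PadicAlgCl p) *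
      (((w⁻¹ : (cycRing ℓ p)ˣ) : cycRing ℓ p) : PadicAlgCl p) = 1 := by
    have h3 : (p : cycRing ℓ p) * ((w⁻¹ : (cycRing ℓ p)ˣ) : cycRing ℓ p) = 1 := by
      rw [← hw, Units.mul_inv]
    exact_mod_cast congrArg (fun z : cycRing ℓ p => ((z : cycField ℓ p) : PadicAlgCl p)) h3
  have h4 := congrArg (PadicAlgCl.valued p).v h2
  have h5 : (PadicAlgCl.valued p).v ((p : cycRing ℓ p) : PadicAlgCl p) < 1 := by
    have h6 : ((p : cycRing ℓ p) : PadicAlgCl p) = (p : PadicAlgCl p) := by push_cast; rfl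
    rw [h6, PadicAlgCl.valuation_p, one_div]
    exact inv_lt_one_of_one_lt₀ (by exact_mod_cast hp.one_lt)
  rw [map_mul, map_one] at h4
  exact absurd h4 (mul_lt_one_of_lt_of_le h5 h1).ne

/-- `k_∞` as an algebra over `𝔽_p`. -/
instance kInf_algebra : Algebra (ZMod p) (kInf ℓ p) := ZMod.algebra (kInf ℓ p) p

end Residue

end

/-! Let `K` be a field of characteristic `p` with a primitive `ℓ ^ n`-th root of unity `ζ`. The
Laplacian of `X_n` commutes with translation by `ℤ/ℓⁿ`. Since `ℓ ^ n ≠ 0` in `K`, the Fourier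
transform along the fibres is invertible and turns this Laplacian into the block diagonal matrix
with blocks `M(ζ ^ c)`, whose determinants are the values of `f` modulo `p` at `ζ ^ c`. The block at
`c = 0` is the singular Laplacian of `X`.

Determinants therefore carry no information, and adjugates are compared instead: summing their
diagonal entries over the fibre of a vertex gives, by the matrix-tree theorem, `ℓ ^ n κ_n = κ_X ∏_{c
≠ 0} f(ζ ^ c)` in `K` (`mul_kappa_derived`). So `p ∤ κ_n` exactly when `p ∤ κ_X` and `f` modulo `p`
has no zero among the `ξ ≠ 1` with `ξ ^ ℓ ^ n = 1` (`not_dvd_kappa_layer_iff`). The field `k_∞`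
contains such a `ζ` for every `n`, so letting `n` vary gives the theorem; `μ = 0` means `g = f`.

The matrix-tree theorem is proved by expanding the determinant row by row into choices of a parent
dart at each vertex: arborescences contribute `1`, all other choices `0`. -/

namespace Multigraph

open Finset

/-! ### Trails -/

/-- The list `c` of directed edges is a path from `x` to `y`. -/
def IsPath (X : Multigraph) : X.V → X.V → List X.Dart → Prop
  | x, y, [] => x = y
  | x, y, e :: c => (X.inc e).1 = x ∧ X.IsPath (X.inc e).2 y c

theorem IsPath.isChain {X : Multigraph} {c : List X.Dart} :
    ∀ {x y : X.V}, X.IsPath x y c → c.IsChain (fun e e' => (X.inc e).2 = (X.inc e').1) := by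
  induction c with
  | nil => intro _ _ _; exact .nil
  | cons e c ih =>
    rintro x y ⟨_, h⟩
    cases c with
    | nil => exact .singleton _
    | cons e' c => exact .cons_cons h.1.symm (ih h)

theorem IsPath.getLast_eq {X : Multigraph} {c : List X.Dart} :
    ∀ {x y : X.V}, X.IsPath x y c → ∀ h : c ≠ [], (X.inc (c.getLast h)).2 = y := by
  induction c with
  | nil => intro _ _ _ h; exact absurd rfl h
  | cons e c ih =>
    rintro x y ⟨_, h⟩ _
    cases c with
    | nil => exact h
    | cons e' c => simpa using ih h (List.cons_ne_nil _ _)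

/-- A path with distinct undirected edges from the terminus of `e` to its origin closes up to a
circuit with `e`, if it does not traverse `e`. -/
theorem IsPath.isCircuit_cons {X : Multigraph} {e : X.Dart} {c : List X.Dart}
    (h : X.IsPath (X.inc e).2 (X.inc e).1 c) (hc : (c.map X.toEdge).Nodup)
    (he : X.toEdge e ∉ c.map X.toEdge) : X.IsCircuit (e :: c) := by
  have h' : X.IsPath (X.inc e).1 (X.inc e).1 (e :: c) := ⟨rfl, h⟩
  exact ⟨h'.isChain, ⟨List.cons_ne_nil _ _, h'.getLast_eq _⟩, List.nodup_cons.2 ⟨he, hc⟩⟩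

theorem toEdge_eq_iff {X : Multigraph} {e e' : X.Dart} :
    X.toEdge e = X.toEdge e' ↔ e' = e ∨ e' = X.inv e :=
  ⟨fun h => (Quotient.exact h : e' = _ ∨ e' = _), fun h => Quotient.sound h⟩

theorem toEdge_inv {X : Multigraph} (e : X.Dart) : X.toEdge (X.inv e) = X.toEdge e :=
  (toEdge_eq_iff.2 (Or.inr rfl)).symm

/-- A path that runs over the edge of `e`, in either direction, visits the origin of `e` and can be
restarted there. This is how `exists_trail` removes repeated edges. -/
theorem IsPath.exists_suffix {X : Multigraph} {e : X.Dart} {c : List X.Dart} :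
    ∀ {x y : X.V}, X.IsPath x y c → X.toEdge e ∈ c.map X.toEdge →
      ∃ c', c' <:+ c ∧ X.IsPath (X.inc e).1 y c' := by
  induction c with
  | nil => simp
  | cons e' c ih =>
    rintro x y ⟨h1, h2⟩ he
    by_cases hee : X.toEdge e = X.toEdge e'
    · rcases toEdge_eq_iff.1 hee with rfl | rfl
      · exact ⟨_, List.suffix_rfl, rfl, h2⟩
      · exact ⟨c, List.suffix_cons _ _, by simpa [X.inc_inv] using h2⟩
    · obtain ⟨c', hc', h⟩ := ih h2 ((List.mem_cons.1 he).resolve_left hee)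
      exact ⟨c', hc'.trans (List.suffix_cons _ _), h⟩

theorem exists_trail {X : Multigraph} {F : Set X.Edge} {x y : X.V}
    (h : Relation.ReflTransGen (fun a b => ∃ e, X.toEdge e ∈ F ∧ X.inc e = (a, b)) x y) :
    ∃ c, X.IsPath x y c ∧ (c.map X.toEdge).Nodup ∧ ∀ e ∈ c, X.toEdge e ∈ F := by
  induction h using Relation.ReflTransGen.head_induction_on with
  | refl => exact ⟨[], rfl, by simp, by simp⟩
  | head h _ ih =>
    obtain ⟨e, heF, he⟩ := h
    obtain ⟨c, h1, h2, h3⟩ := ih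
    by_cases hec : X.toEdge e ∈ c.map X.toEdge
    · obtain ⟨c', hc', h⟩ := h1.exists_suffix hec
      refine ⟨c', by simpa [he] using h, h2.sublist (hc'.map _).sublist,
        fun e' h' => h3 e' (hc'.subset h')⟩
    · refine ⟨e :: c, ⟨by rw [he], by rwa [he]⟩, List.nodup_cons.2 ⟨hec, h2⟩, ?_⟩
      rintro e' (_ | ⟨_, h'⟩)
      exacts [heF, h3 e' h']

/-! ### Arborescences -/

/-- The map `φ` chooses at each vertex except the root `v₀` a directed edge to its parent, such that
going to the parent decreases some height function. -/
structure IsArborescence (X : Multigraph) (v₀ : X.V) (φ : X.V → Option X.Dart) : Prop where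
  root : φ v₀ = none
  exists_parent : ∀ x, x ≠ v₀ → ∃ e, φ x = some e
  origin : ∀ x e, φ x = some e → (X.inc e).1 = x
  exists_height : ∃ d : X.V → ℕ, ∀ x e, φ x = some e → d (X.inc e).2 < d x

/-- The undirected edges underlying a choice of directed edges. -/
def edgesOf (X : Multigraph) (φ : X.V → Option X.Dart) : Set X.Edge :=
  {a | ∃ x e, φ x = some e ∧ X.toEdge e = a}

variable {X : Multigraph} {v₀ : X.V} {φ ψ : X.V → Option X.Dart}

theorem IsArborescence.eq_or_eq_inv (h : X.IsArborescence v₀ φ) {e : X.Dart}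
    (he : X.toEdge e ∈ X.edgesOf φ) :
    φ (X.inc e).1 = some e ∨ φ (X.inc e).2 = some (X.inv e) := by
  obtain ⟨x, e', h1, h2⟩ := he
  have h3 := h.origin x e' h1
  rcases toEdge_eq_iff.1 h2 with rfl | rfl
  · exact Or.inl (h3 ▸ h1)
  · refine Or.inr ?_
    rw [X.inv_inv, X.inc_inv, Prod.snd_swap, h3, h1]

theorem IsArborescence.connectedOn (h : X.IsArborescence v₀ φ) : X.ConnectedOn (X.edgesOf φ) := by
  refine ⟨⟨v₀⟩, ?_⟩
  obtain ⟨d, hd⟩ := h.exists_height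
  set R : X.V → X.V → Prop := fun a b => ∃ e, X.toEdge e ∈ X.edgesOf φ ∧ X.inc e = (a, b)
  have hsymm : ∀ a b, R a b → R b a := by
    rintro a b ⟨e, he, hab⟩
    exact ⟨X.inv e, by rwa [toEdge_inv], by rw [X.inc_inv, hab]; rfl⟩
  have hroot : ∀ n x, d x = n → Relation.ReflTransGen R x v₀ := by
    intro n
    induction n using Nat.strong_induction_on with
    | _ n ih =>
      intro x hx
      by_cases hxv : x = v₀
      · rw [hxv]
      obtain ⟨e, he⟩ := h.exists_parent x hxv
      refine .head ⟨e, ⟨x, e, he, rfl⟩, ?_⟩ (ih _ (hx ▸ hd x e he) _ rfl)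
      rw [← h.origin x e he]
  intro x y
  refine (hroot _ x rfl).trans ?_
  have := (Relation.reflTransGen_swap (r := R)).2 (hroot _ y rfl)
  exact Relation.ReflTransGen.mono (fun a b hab => hsymm b a hab) v₀ y this

/-- Each dart of such a circuit leads either to a parent (`down`) or away from one (`up`). After an
`up` dart, a `down` dart could only be its inverse, which would repeat an edge. So `up` persists
forwards and `down` backwards, and the height would change strictly around the circuit unless it
starts `down` and ends `up`; then the first dart is the inverse of the last. -/
theorem IsArborescence.not_isCircuit (h : X.IsArborescence v₀ φ) {c : List X.Dart}
    (hcirc : X.IsCircuit c) (hc : ∀ e ∈ c, X.toEdge e ∈ X.edgesOf φ) : False := by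
  obtain ⟨d, hd⟩ := h.exists_height
  obtain ⟨hchain, ⟨hne, hclose⟩, hnodup⟩ := hcirc
  let up : X.Dart → Prop := fun e => φ (X.inc e).2 = some (X.inv e)
  let down : X.Dart → Prop := fun e => φ (X.inc e).1 = some e
  have hup : ∀ e, up e → d (X.inc e).1 < d (X.inc e).2 := by
    intro e he
    simpa [X.inc_inv] using hd _ _ he
  have hallup : ∀ (c : List X.Dart), c.IsChain (fun e e' => (X.inc e).2 = (X.inc e').1) →
      (c.map X.toEdge).Nodup → (∀ e ∈ c, X.toEdge e ∈ X.edgesOf φ) → ∀ hne : c ≠ [],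
      up (c.head hne) → d (X.inc (c.head hne)).1 < d (X.inc (c.getLast hne)).2 := by
    intro c
    induction c with
    | nil => intro _ _ _ h; exact absurd rfl h
    | cons e c ih =>
      intro h1 h2 h3 _ he
      cases c with
      | nil => exact hup e he
      | cons e' c =>
        rw [List.isChain_cons_cons] at h1
        rw [List.map_cons, List.nodup_cons] at h2
        have he' : up e' := by
          refine (h.eq_or_eq_inv (h3 e' (by simp))).resolve_left fun h4 => h2.1 ?_
          have he₀ : φ (X.inc e).2 = some (X.inv e) := he
          rw [← h1.1, he₀] at h4
          rw [← toEdge_inv, Option.some.inj h4]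
          simp
        have := ih h1.2 h2.2 (fun a ha => h3 a (List.mem_cons_of_mem _ ha))
          (List.cons_ne_nil _ _) he'
        have h5 := hup e he
        simp only [List.head_cons, List.getLast_cons_cons] at this ⊢
        rw [← h1.1] at this
        omega
  have halldown : ∀ (c : List X.Dart), c.IsChain (fun e e' => (X.inc e).2 = (X.inc e').1) →
      (c.map X.toEdge).Nodup → (∀ e ∈ c, X.toEdge e ∈ X.edgesOf φ) → ∀ hne : c ≠ [],
      down (c.getLast hne) →
        down (c.head hne) ∧ d (X.inc (c.getLast hne)).2 < d (X.inc (c.head hne)).1 := by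
    intro c
    induction c with
    | nil => intro _ _ _ h; exact absurd rfl h
    | cons e c ih =>
      intro h1 h2 h3 _ he
      cases c with
      | nil => exact ⟨he, hd _ _ he⟩
      | cons e' c =>
        rw [List.isChain_cons_cons] at h1
        rw [List.map_cons, List.nodup_cons] at h2
        obtain ⟨h4, h5⟩ := ih h1.2 h2.2 (fun a ha => h3 a (List.mem_cons_of_mem _ ha))
          (List.cons_ne_nil _ _) (by simpa using he)
        simp only [List.head_cons, List.getLast_cons_cons] at h4 h5 ⊢
        have h6 : down e := by
          refine (h.eq_or_eq_inv (h3 e (by simp))).resolve_right fun h7 => h2.1 ?_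
          have h4' : φ (X.inc e').1 = some e' := h4
          rw [h1.1, h4'] at h7
          rw [← toEdge_inv, ← Option.some.inj h7]
          simp
        have h8 := hd _ _ h6
        rw [h1.1] at h8
        exact ⟨h6, h5.trans h8⟩
  have hlast : up (c.getLast hne) :=
    (h.eq_or_eq_inv (hc _ (List.getLast_mem hne))).resolve_left fun h1 => by
      have := (halldown c hchain hnodup hc hne h1).2
      rw [hclose] at this
      exact lt_irrefl _ this
  have hhead : down (c.head hne) :=
    (h.eq_or_eq_inv (hc _ (List.head_mem hne))).resolve_right fun h1 => by
      have := hallup c hchain hnodup hc hne h1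
      rw [hclose] at this
      exact lt_irrefl _ this
  have hinv : c.head hne = X.inv (c.getLast hne) := by
    have h1 : φ (X.inc (c.getLast hne)).2 = _ := hlast
    have h2 : φ (X.inc (c.head hne)).1 = _ := hhead
    rw [hclose, h2] at h1
    exact Option.some.inj h1
  -- The two darts have the same undirected edge, so they sit at the same position of the list and
  -- the circuit has length one; but no dart is its own inverse.
  have heq : c.head hne = c.getLast hne := by
    refine List.inj_on_of_nodup_map hnodup (List.head_mem hne) (List.getLast_mem hne) ?_
    rw [hinv, toEdge_inv]
  exact X.inv_ne _ (hinv.symm.trans heq)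

theorem IsArborescence.isSpanningTree (h : X.IsArborescence v₀ φ) :
    X.IsSpanningTree (X.edgesOf φ) :=
  ⟨h.connectedOn, fun ⟨_, hc, hc'⟩ => h.not_isCircuit hc hc'⟩

/-- Induction on the height for `ψ`: if `φ` used the parent edge of `x` in the opposite direction,
then `φ`, hence by induction `ψ`, would make `x` the parent of its own parent. -/
theorem IsArborescence.eq_of_edgesOf_eq (hφ : X.IsArborescence v₀ φ) (hψ : X.IsArborescence v₀ ψ)
    (h : X.edgesOf φ = X.edgesOf ψ) : φ = ψ := by
  obtain ⟨d, hd⟩ := hψ.exists_height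
  suffices ∀ n x, d x = n → φ x = ψ x from funext fun x => this _ x rfl
  intro n
  induction n using Nat.strong_induction_on with
  | _ n ih =>
    intro x hx
    by_cases hxv : x = v₀
    · rw [hxv, hφ.root, hψ.root]
    obtain ⟨e, he⟩ := hψ.exists_parent x hxv
    have hx' := hψ.origin x e he
    have h1 : X.toEdge e ∈ X.edgesOf φ := h ▸ ⟨x, e, he, rfl⟩
    rcases hφ.eq_or_eq_inv h1 with h2 | h2
    · rw [he, ← h2, hx']
    · exfalso
      have h3 := hd x e he
      have h4 := ih _ (hx ▸ h3) (X.inc e).2 rfl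
      rw [h2] at h4
      have h5 := hd _ _ h4.symm
      rw [X.inc_inv] at h5
      simp only [Prod.snd_swap, hx'] at h5
      omega

/-- The parent dart is the first dart of a shortest path to `v₀` inside `F`, and the height is the
distance to `v₀`. -/
theorem IsSpanningTree.exists_isArborescence {F : Set X.Edge} (hF : X.IsSpanningTree F)
    (v₀ : X.V) : ∃ φ, X.IsArborescence v₀ φ ∧ X.edgesOf φ = F := by
  classical
  obtain ⟨⟨_, hconn⟩, hcirc⟩ := hF
  let reach : ℕ → X.V → Prop := fun n x =>
    ∃ c : List X.Dart, c.length = n ∧ X.IsPath x v₀ c ∧ ∀ e ∈ c, X.toEdge e ∈ F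
  have hreach : ∀ x, ∃ n, reach n x := fun x => by
    obtain ⟨c, h1, _, h3⟩ := exists_trail (hconn x v₀)
    exact ⟨_, c, rfl, h1, h3⟩
  let d : X.V → ℕ := fun x => Nat.find (hreach x)
  have hstep : ∀ x, x ≠ v₀ → ∃ e, (X.inc e).1 = x ∧ X.toEdge e ∈ F ∧ d (X.inc e).2 < d x := by
    intro x hx
    obtain ⟨c, h1, h2, h3⟩ := Nat.find_spec (hreach x)
    cases c with
    | nil => exact absurd h2 hx
    | cons e c =>
      refine ⟨e, h2.1, h3 e (by simp), ?_⟩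
      have h4 : d (X.inc e).2 ≤ c.length :=
        Nat.find_min' _ ⟨c, rfl, h2.2, fun a ha => h3 a (List.mem_cons_of_mem _ ha)⟩
      have h5 : c.length + 1 = d x := h1
      omega
  choose p hp1 hp2 hp3 using hstep
  let φ : X.V → Option X.Dart := fun x => if h : x = v₀ then none else some (p x h)
  have hsome : ∀ x e, φ x = some e → ∃ h : x ≠ v₀, p x h = e := by
    intro x e he
    by_cases hx : x = v₀
    · simp [φ, hx] at he
    · exact ⟨hx, by simpa [φ, hx] using he⟩
  have hφ : X.IsArborescence v₀ φ :=
    { root := by simp [φ]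
      exists_parent := fun x hx => ⟨p x hx, by simp [φ, hx]⟩
      origin := fun x e he => by
        obtain ⟨hx, rfl⟩ := hsome x e he
        exact hp1 x hx
      exists_height := ⟨d, fun x e he => by
        obtain ⟨hx, rfl⟩ := hsome x e he
        exact hp3 x hx⟩ }
  have hsub : X.edgesOf φ ⊆ F := by
    rintro _ ⟨x, e, he, rfl⟩
    obtain ⟨hx, rfl⟩ := hsome x e he
    exact hp2 x hx
  refine ⟨φ, hφ, hsub.antisymm fun a ha => ?_⟩
  -- An edge of `F` that is not a parent edge would close up with a trail of parent edges to a
  -- circuit in `F`.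
  by_contra hna
  obtain ⟨e, rfl⟩ : ∃ e, X.toEdge e = a := Quotient.exists_rep a
  obtain ⟨c, h1, h2, h3⟩ := exists_trail (hφ.connectedOn.2 (X.inc e).2 (X.inc e).1)
  refine hcirc ⟨e :: c, h1.isCircuit_cons h2 ?_, ?_⟩
  · intro hmem
    obtain ⟨e', he', h4⟩ := List.mem_map.1 hmem
    exact hna (h4 ▸ h3 e' he')
  · rintro e' (_ | ⟨_, h'⟩)
    exacts [ha, hsub (h3 e' h')]

/-- Spanning trees correspond to arborescences with a fixed root. -/
theorem kappa_eq_ncard (v₀ : X.V) : X.kappa = {φ | X.IsArborescence v₀ φ}.ncard := by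
  have h1 : {F | X.IsSpanningTree F} = X.edgesOf '' {φ | X.IsArborescence v₀ φ} := by
    ext F
    constructor
    · exact fun hF => hF.exists_isArborescence v₀
    · rintro ⟨φ, hφ, rfl⟩
      exact hφ.isSpanningTree
  rw [kappa, h1]
  exact Set.InjOn.ncard_image fun φ hφ ψ hψ h => hφ.eq_of_edgesOf_eq hψ h

/-! ### The matrix-tree theorem -/

section MatrixTree

variable [DecidableEq X.V]

/-- The Laplacian matrix of `X` with the directed edges weighted by `w`. -/
def weightedLaplacian (X : Multigraph) [Fintype X.Dart] [DecidableEq X.V] {R : Type*} [CommRing R]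
    (w : X.Dart → R) : Matrix X.V X.V R :=
  Matrix.of fun x y => ∑ e with (X.inc e).1 = x,
    ((if x = y then 1 else 0) - if (X.inc e).2 = y then w e else 0)

/-- The row of a vertex `x` in the matrix attached to a choice of parents. -/
def parentRow (X : Multigraph) [DecidableEq X.V] (x : X.V) (o : Option X.Dart) : X.V → ℤ :=
  Pi.single x 1 - o.elim 0 fun e => Pi.single (X.inc e).2 1

variable [Fintype X.V]

/-- Off the diagonal, the row of `x` is supported at the parent of `x`, which has smaller height.
Ordered by height, the matrix is unitriangular. -/
theorem IsArborescence.det_parentRow (h : X.IsArborescence v₀ φ) :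
    (Matrix.of fun x => X.parentRow x (φ x)).det = 1 := by
  obtain ⟨d, hd⟩ := h.exists_height
  have hzero : ∀ x y, x ≠ y → d x ≤ d y → X.parentRow x (φ x) y = 0 := by
    intro x y hxy hle
    rcases ho : φ x with _ | e
    · simp [parentRow, hxy.symm]
    · have h1 := hd x e ho
      have h2 : y ≠ (X.inc e).2 := by
        rintro rfl
        omega
      simp [parentRow, hxy.symm, h2]
  have hone : ∀ x, X.parentRow x (φ x) x = 1 := by
    intro x
    rcases ho : φ x with _ | e
    · simp [parentRow]
    · have h1 := hd x e ho
      have h2 : x ≠ (X.inc e).2 := by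
        intro h
        rw [← h] at h1
        omega
      simp [parentRow, h2]
  have htri : (Matrix.of fun x => X.parentRow x (φ x)).BlockTriangular
      fun x => OrderDual.toDual (d x) := by
    intro x y hxy
    have hlt : d x < d y := hxy
    exact hzero x y (by rintro rfl; exact lt_irrefl _ hlt) hlt.le
  rw [htri.det]
  refine Finset.prod_eq_one fun a _ => ?_
  suffices h1 : (Matrix.of fun x => X.parentRow x (φ x)).toSquareBlock
      (fun x => OrderDual.toDual (d x)) a = 1 by rw [h1, Matrix.det_one]
  ext ⟨x, hx⟩ ⟨y, hy⟩
  by_cases hxy : x = y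
  · subst hxy
    simpa [Matrix.toSquareBlock_def] using hone x
  · have hxd : d x = d y := OrderDual.toDual.injective (hx.trans hy.symm)
    simpa [Matrix.toSquareBlock_def, Matrix.one_apply, hxy] using hzero x y hxy hxd.le

/-- Some vertex never reaches the root by passing to parents. The indicator function of all such
vertices takes equal values at a vertex and its parent and vanishes at the root, so it lies in the
kernel. -/
theorem det_parentRow_eq_zero (hroot : φ v₀ = none) (hparent : ∀ x, x ≠ v₀ → ∃ e, φ x = some e)
    (horigin : ∀ x e, φ x = some e → (X.inc e).1 = x) (h : ¬ X.IsArborescence v₀ φ) :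
    (Matrix.of fun x => X.parentRow x (φ x)).det = 0 := by
  classical
  let next : X.V → X.V := fun x => (φ x).elim x fun e => (X.inc e).2
  have hnext : ∀ x e, φ x = some e → next x = (X.inc e).2 := fun x e he => by simp [next, he]
  have hex : ∃ x, ∀ n, next^[n] x ≠ v₀ := by
    -- If every vertex reached the root, the number of steps needed would be a height function.
    by_contra! hall
    refine h ⟨hroot, hparent, horigin, fun x => Nat.find (hall x), fun x e he => ?_⟩
    have hs := Nat.find_spec (hall x)
    change Nat.find (hall (X.inc e).2) < Nat.find (hall x)
    rcases hn : Nat.find (hall x) with _ | m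
    · rw [hn] at hs
      have : x = v₀ := hs
      rw [this, hroot] at he
      cases he
    · rw [hn, Function.iterate_succ_apply, hnext x e he] at hs
      exact Nat.lt_succ_of_le (Nat.find_min' (hall (X.inc e).2) hs)
  obtain ⟨x₀, hx₀⟩ := hex
  rw [← Matrix.exists_mulVec_eq_zero_iff]
  refine ⟨fun x => if ∀ n, next^[n] x ≠ v₀ then 1 else 0, fun h0 => ?_, ?_⟩
  · have := congrFun h0 x₀
    rw [if_pos hx₀] at this
    exact one_ne_zero this
  · ext x
    rcases ho : φ x with _ | e
    · have hx : x = v₀ := by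
        by_contra hx
        obtain ⟨e, he⟩ := hparent x hx
        rw [ho] at he
        cases he
      have h1 : ¬ ∀ n, next^[n] x ≠ v₀ := fun h => h 0 hx
      simp only [Matrix.mulVec, Matrix.of_apply, parentRow, ho, Option.elim_none, sub_zero,
        single_dotProduct, one_mul, Pi.zero_apply]
      exact if_neg h1
    · have h1 : (∀ n, next^[n] x ≠ v₀) ↔ ∀ n, next^[n] (X.inc e).2 ≠ v₀ := by
        rw [← hnext x e ho]
        refine ⟨fun h n => h (n + 1), fun h n => ?_⟩
        rcases n with _ | n
        · intro hx
          have : x = v₀ := hx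
          rw [this, hroot] at ho
          cases ho
        · exact h n
      simp only [Matrix.mulVec, Matrix.of_apply, parentRow, ho, Option.elim_some,
        sub_dotProduct, single_dotProduct, one_mul, Pi.zero_apply]
      simp only [h1, sub_self]

variable [Fintype X.Dart]

/-- The matrix-tree theorem. -/
theorem adjugate_weightedLaplacian_one (v₀ : X.V) :
    (X.weightedLaplacian (1 : X.Dart → ℤ)).adjugate v₀ v₀ = X.kappa := by
  classical
  -- The admissible choices at each vertex. The choice `none` at the root gives the unit vector that
  -- replaces the row of `v₀` in the adjugate entry.
  let A : X.V → Finset (Option X.Dart) := fun x =>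
    if x = v₀ then {none} else (univ.filter fun e => (X.inc e).1 = x).map .some
  have hA : ∀ φ, φ ∈ Fintype.piFinset A ↔ φ v₀ = none ∧ (∀ x, x ≠ v₀ → ∃ e, φ x = some e) ∧
      ∀ x e, φ x = some e → (X.inc e).1 = x := by
    intro φ
    rw [Fintype.mem_piFinset]
    constructor
    · intro h
      have h0 : φ v₀ = none := by simpa [A] using h v₀
      refine ⟨h0, fun x hx => ?_, fun x e he => ?_⟩
      · have := h x
        simp only [A, hx, if_false, Finset.mem_map] at this
        obtain ⟨e, _, he⟩ := this
        exact ⟨e, he.symm⟩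
      · have hx : x ≠ v₀ := by
          rintro rfl
          rw [h0] at he
          cases he
        have := h x
        simpa [A, hx, he] using this
    · rintro ⟨h0, h1, h2⟩ x
      by_cases hx : x = v₀
      · simp [A, hx, h0]
      · obtain ⟨e, he⟩ := h1 x hx
        simp [A, hx, he, h2 x e he]
  have hrows : (X.weightedLaplacian (1 : X.Dart → ℤ)).updateRow v₀ (Pi.single v₀ 1) =
      fun x => ∑ o ∈ A x, X.parentRow x o := by
    ext x y
    by_cases hx : x = v₀
    · subst hx
      simp [A, parentRow]
    · rw [Matrix.updateRow_ne hx]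
      simp only [A, hx, if_false, Finset.sum_map, Finset.sum_apply, weightedLaplacian,
        Matrix.of_apply]
      refine Finset.sum_congr rfl fun e _ => ?_
      simp [parentRow, Pi.single_apply, eq_comm]
  have hdet : (X.weightedLaplacian (1 : X.Dart → ℤ)).adjugate v₀ v₀ =
      ∑ φ ∈ Fintype.piFinset A, (Matrix.of fun x => X.parentRow x (φ x)).det := by
    rw [Matrix.adjugate_apply, hrows]
    exact (Matrix.detRowAlternating (R := ℤ) (n := X.V)).toMultilinearMap.map_sum_finset
      (fun x o => X.parentRow x o) A
  have hval : ∀ φ ∈ Fintype.piFinset A, (Matrix.of fun x => X.parentRow x (φ x)).det =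
      if X.IsArborescence v₀ φ then 1 else 0 := by
    intro φ hφ
    obtain ⟨h0, h1, h2⟩ := (hA φ).1 hφ
    split_ifs with h
    · exact h.det_parentRow
    · exact det_parentRow_eq_zero h0 h1 h2 h
  rw [hdet, Finset.sum_congr rfl hval, Finset.sum_boole, kappa_eq_ncard v₀, ← Set.ncard_coe_finset]
  congr 2
  ext φ
  simp only [Finset.coe_filter, Set.mem_ofPred_eq, and_iff_right_iff_imp]
  exact fun h => (hA φ).2 ⟨h.root, h.exists_parent, h.origin⟩

end MatrixTree

end Multigraph

/-! ### Adjugates of block diagonal matrices -/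

namespace Matrix

open Finset

variable {m o R : Type*} [Fintype m] [DecidableEq m] [Fintype o] [DecidableEq o] [CommRing R]

/-- Replacing a row by the unit vector at its diagonal position keeps the matrix block diagonal and
changes only the block `c`. -/
theorem adjugate_blockDiagonal_apply_self (M : o → Matrix m m R) (i : m) (c : o) :
    (blockDiagonal M).adjugate (i, c) (i, c) =
      (M c).adjugate i i * ∏ c' ∈ univ.erase c, (M c').det := by
  have h : (blockDiagonal M).updateRow (i, c) (Pi.single (i, c) 1) =
      blockDiagonal (Function.update M c ((M c).updateRow i (Pi.single i 1))) := by
    ext ⟨x, a⟩ ⟨y, b⟩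
    simp only [updateRow_apply, blockDiagonal_apply, Prod.mk.injEq, Pi.single_apply]
    by_cases ha : a = c
    · subst ha
      by_cases hb : a = b
      · subst hb
        by_cases hx : x = i <;> simp [hx, updateRow_apply, Pi.single_apply]
      · by_cases hx : x = i <;> simp [hx, hb, Ne.symm hb]
    · simp [ha, Function.update_of_ne]
  rw [adjugate_apply, adjugate_apply, h, det_blockDiagonal,
    ← Finset.mul_prod_erase univ _ (mem_univ c), Function.update_self]
  congr 1
  refine Finset.prod_congr rfl fun c' hc' => ?_
  rw [Function.update_of_ne (Finset.ne_of_mem_erase hc')]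

/-- Adjugates are antimultiplicative, so a conjugation carries over to them even when `A` is
singular, as the Laplacian is. Commuting with `P` lets `E` select part of the diagonal, here the
fibre over one vertex. -/
theorem trace_adjugate_mul_eq_of_conj {A B P E : Matrix m m R} (hP : IsUnit P.det)
    (hAB : A * P = P * B) (hE : E * P = P * E) :
    (A.adjugate * E).trace = (B.adjugate * E).trace := by
  have h1 : P.adjugate * A.adjugate = B.adjugate * P.adjugate := by
    rw [← adjugate_mul_distrib, ← adjugate_mul_distrib, hAB]
  have h2 : P.det • A.adjugate = P * B.adjugate * P.adjugate := by
    rw [Matrix.mul_assoc, ← h1, ← Matrix.mul_assoc, mul_adjugate, smul_mul, Matrix.one_mul]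
  refine hP.mul_left_cancel ?_
  calc P.det * (A.adjugate * E).trace = (P * (B.adjugate * P.adjugate * E)).trace := by
        rw [← smul_eq_mul, ← trace_smul, ← smul_mul, h2]
        simp only [Matrix.mul_assoc]
    _ = (B.adjugate * (P.adjugate * P) * E).trace := by
        rw [trace_mul_comm]
        simp only [Matrix.mul_assoc, hE]
    _ = P.det * (B.adjugate * E).trace := by
        rw [adjugate_mul, Matrix.mul_smul, Matrix.mul_one, smul_mul, trace_smul, smul_eq_mul]

theorem trace_mul_diagonal_fst (A : Matrix (m × o) (m × o) R) (i : m) :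
    (A * diagonal fun x : m × o => if x.1 = i then 1 else 0).trace = ∑ c, A (i, c) (i, c) := by
  simp only [trace, diag_apply, mul_diagonal, Fintype.sum_prod_type, mul_ite, mul_one, mul_zero]
  rw [Finset.sum_comm]
  simp

end Matrix

/-! ### Fourier transform of the Laplacian of a derived multigraph -/

namespace Multigraph

open Finset

variable {X : Multigraph} [DecidableEq X.V] [Fintype X.Dart]

instance {A : Type} [AddCommGroup A] [Fintype A] [Fintype X.V] (σ : X.Sect) (α : σ.S → A) :
    Fintype (X.derived σ α).V := inferInstanceAs (Fintype (X.V × A))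

instance {A : Type} [AddCommGroup A] [DecidableEq A] (σ : X.Sect) (α : σ.S → A) :
    DecidableEq (X.derived σ α).V := inferInstanceAs (DecidableEq (X.V × A))

instance {A : Type} [AddCommGroup A] [Fintype A] (σ : X.Sect) (α : σ.S → A) :
    Fintype (X.derived σ α).Dart := inferInstanceAs (Fintype (X.Dart × A))

theorem weightedLaplacian_map {R S : Type*} [CommRing R] [CommRing S] (f : R →+* S)
    (w : X.Dart → R) :
    (X.weightedLaplacian w).map f = X.weightedLaplacian fun e => f (w e) := by
  ext x y
  simp [weightedLaplacian, map_sum, apply_ite f]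

variable [Fintype X.V]

theorem adjugate_weightedLaplacian_one' {R : Type*} [CommRing R] (v₀ : X.V) :
    (X.weightedLaplacian (1 : X.Dart → R)).adjugate v₀ v₀ = X.kappa := by
  have h := congrArg (Int.castRingHom R) (adjugate_weightedLaplacian_one v₀)
  have h1 : X.weightedLaplacian (1 : X.Dart → R) =
      (Int.castRingHom R).mapMatrix (X.weightedLaplacian (1 : X.Dart → ℤ)) := by
    rw [RingHom.mapMatrix_apply, weightedLaplacian_map]
    congr 1
    ext e
    simp
  rw [h1, ← RingHom.map_adjugate]
  simpa using h

theorem det_weightedLaplacian_one {R : Type*} [CommRing R] [IsDomain R] [Nonempty X.V] :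
    (X.weightedLaplacian (1 : X.Dart → R)).det = 0 := by
  rw [← Matrix.exists_mulVec_eq_zero_iff]
  refine ⟨fun _ => 1, fun h => one_ne_zero (congrFun h (Classical.arbitrary X.V)), ?_⟩
  ext x
  simp only [Matrix.mulVec, dotProduct, weightedLaplacian, Matrix.of_apply, mul_one, Pi.zero_apply]
  rw [Finset.sum_comm]
  exact Finset.sum_eq_zero fun e _ => by simp

/-- The Laplacian of a derived multigraph over `ℤ/N` becomes block diagonal under the Fourier
transform, which gives its number of spanning trees. -/
theorem mul_kappa_derived {K : Type*} [Field K] {N : ℕ} [NeZero N] (hN : (N : K) ≠ 0)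
    {ψ : AddChar (ZMod N) K} (hψ : ψ.IsPrimitive) (σ : X.Sect) (α : σ.S → ZMod N) [Nonempty X.V] :
    (N : K) * (X.derived σ α).kappa = X.kappa *
      ∏ c ∈ univ.erase (0 : ZMod N),
        (X.weightedLaplacian fun e => ψ (σ.extend α e * c)).det := by
  let v₀ := Classical.arbitrary X.V
  let M : ZMod N → Matrix X.V X.V K := fun c =>
    X.weightedLaplacian fun e => ψ (σ.extend α e * c)
  let A : Matrix (X.V × ZMod N) (X.V × ZMod N) K :=
    (X.derived σ α).weightedLaplacian (1 : (X.derived σ α).Dart → K)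
  -- `P` is the Fourier transform along the fibres; `Q` is its inverse up to the factor `N`, by
  -- orthogonality of characters.
  let P : Matrix (X.V × ZMod N) (X.V × ZMod N) K :=
    Matrix.of fun x y => if x.1 = y.1 then ψ (x.2 * y.2) else 0
  let Q : Matrix (X.V × ZMod N) (X.V × ZMod N) K :=
    Matrix.of fun x y => if x.1 = y.1 then ψ (-(x.2 * y.2)) else 0
  have hM0 : M 0 = X.weightedLaplacian (1 : X.Dart → K) := by
    simp only [M]
    congr 1
    ext e
    simp
  have hPQ : P * Q = (N : K) • 1 := by
    ext ⟨x, a⟩ ⟨y, b⟩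
    have h1 : ∑ c : ZMod N, ψ (c * (a - b)) = if a - b = 0 then (N : K) else 0 := by
      rw [AddChar.sum_mulShift _ hψ, ZMod.card, Nat.cast_ite, Nat.cast_zero]
    have h2 : ∀ c : ZMod N, ψ (a * c) * ψ (-(c * b)) = ψ (c * (a - b)) := fun c => by
      rw [← AddChar.map_add_eq_mul]
      congr 1
      ring
    simp only [P, Q, Matrix.mul_apply, Matrix.of_apply, Fintype.sum_prod_type, ite_mul, mul_ite,
      zero_mul, mul_zero]
    rw [Finset.sum_comm]
    by_cases hxy : x = y
    · subst hxy
      simp [h2, h1, sub_eq_zero, Matrix.one_apply]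
    · simp [hxy]
  have hP : IsUnit P.det := by
    have h1 := congrArg Matrix.det hPQ
    rw [Matrix.det_mul, Matrix.det_smul, Matrix.det_one, mul_one] at h1
    exact isUnit_iff_ne_zero.2 (left_ne_zero_of_mul (h1 ▸ pow_ne_zero _ hN))
  have hAP : A * P = P * Matrix.blockDiagonal M := by
    have hA : ∀ x a z, A (x, a) z = ∑ e with (X.inc e).1 = x,
        ((if (x, a) = z then 1 else 0) -
          if ((X.inc e).2, a + σ.extend α e) = z then 1 else 0) := by
      intro x a z
      change (∑ e : X.Dart × ZMod N with ((X.inc e.1).1, e.2) = (x, a),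
        ((if (x, a) = z then (1 : K) else 0) -
          if ((X.inc e.1).2, e.2 + σ.extend α e.1) = z then 1 else 0)) = _
      -- Over each dart `e` with origin `x` exactly one dart starts at `(x, a)`, namely `(e, a)`.
      refine Finset.sum_nbij' (fun e : X.Dart × ZMod N => e.1) (fun e => (e, a)) ?_ ?_ ?_ ?_ ?_
      · intro e he
        rw [Finset.mem_filter] at he ⊢
        exact ⟨mem_univ _, congrArg Prod.fst he.2⟩
      · intro e he
        rw [Finset.mem_filter] at he ⊢
        exact ⟨mem_univ _, Prod.ext he.2 rfl⟩
      · intro e he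
        rw [Finset.mem_filter] at he
        exact Prod.ext rfl (congrArg Prod.snd he.2).symm
      · intro e _
        rfl
      · intro e he
        rw [Finset.mem_filter] at he
        have h1 : e.2 = a := congrArg Prod.snd he.2
        rw [h1]
    ext ⟨x, a⟩ ⟨y, c⟩
    have h1 : (A * P) (x, a) (y, c) = ∑ e with (X.inc e).1 = x,
        (P (x, a) (y, c) - P ((X.inc e).2, a + σ.extend α e) (y, c)) := by
      simp only [Matrix.mul_apply, hA, Finset.sum_mul]
      rw [Finset.sum_comm]
      refine Finset.sum_congr rfl fun e _ => ?_
      simp only [sub_mul, ite_mul, one_mul, zero_mul, Finset.sum_sub_distrib, Finset.sum_ite_eq,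
        mem_univ, if_true]
    have h2 : (P * Matrix.blockDiagonal M) (x, a) (y, c) = ψ (a * c) * M c x y := by
      simp [Matrix.mul_apply, Fintype.sum_prod_type, P, Matrix.blockDiagonal_apply]
    rw [h1, h2]
    simp only [M, P, weightedLaplacian, Matrix.of_apply, Finset.mul_sum]
    refine Finset.sum_congr rfl fun e _ => ?_
    rw [add_mul, AddChar.map_add_eq_mul]
    split_ifs <;> ring
  have hE : (Matrix.diagonal fun x : X.V × ZMod N => if x.1 = v₀ then (1 : K) else 0) * P =
      P * Matrix.diagonal fun x => if x.1 = v₀ then 1 else 0 := by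
    ext ⟨x, a⟩ ⟨y, b⟩
    by_cases hxy : x = y
    · simp [P, hxy]
    · simp [P, hxy]
  have h := Matrix.trace_adjugate_mul_eq_of_conj hP hAP hE
  rw [Matrix.trace_mul_diagonal_fst, Matrix.trace_mul_diagonal_fst] at h
  have h3 : ∀ a : ZMod N, A.adjugate (v₀, a) (v₀, a) = (X.derived σ α).kappa := fun a =>
    adjugate_weightedLaplacian_one' (X := X.derived σ α) (v₀, a)
  -- For `c ≠ 0` the product over the other blocks contains the singular block at `0`.
  have h4 : ∀ c : ZMod N, c ≠ 0 → (Matrix.blockDiagonal M).adjugate (v₀, c) (v₀, c) = 0 := by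
    intro c hc
    rw [Matrix.adjugate_blockDiagonal_apply_self, Finset.prod_eq_zero
      (Finset.mem_erase.2 ⟨hc.symm, mem_univ _⟩) (hM0 ▸ det_weightedLaplacian_one), mul_zero]
  rw [Finset.sum_congr rfl fun a _ => h3 a, Finset.sum_eq_single 0 (fun c _ hc => h4 c hc)
    (fun h => absurd (mem_univ _) h), Matrix.adjugate_blockDiagonal_apply_self, hM0,
    adjugate_weightedLaplacian_one'] at h
  simpa [ZMod.card] using h

end Multigraph

theorem cast_prime_pow_ne_zero {ℓ p : ℕ} [Fact ℓ.Prime] [Fact p.Prime] (hpl : p ≠ ℓ)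
    {K : Type*} [CommRing K] [CharP K p] (n : ℕ) : ((ℓ ^ n : ℕ) : K) ≠ 0 := by
  rw [Ne, CharP.cast_eq_zero_iff K p]
  intro h
  exact hpl ((Nat.prime_dvd_prime_iff_eq Fact.out Fact.out).1
    (Nat.Prime.dvd_of_dvd_pow Fact.out h))

/-! ### Evaluation of generalized polynomials -/

section Eval

variable {ℓ : ℕ} [Fact ℓ.Prime] {K : Type*} [CommRing K]

theorem adicPow_zero (ξ : muEllInf ℓ K) : adicPow ξ 0 = 1 := by
  obtain ⟨n, hn⟩ := ξ.2
  rw [adicPow_eq ξ 0 n hn, map_zero, ZMod.val_zero, pow_zero]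

theorem adicPow_add (ξ : muEllInf ℓ K) (a b : ℤ_[ℓ]) :
    adicPow ξ (a + b) = adicPow ξ a * adicPow ξ b := by
  obtain ⟨n, hn⟩ := ξ.2
  have : NeZero (ℓ ^ n) := ⟨pow_ne_zero _ (Fact.out (p := ℓ.Prime)).ne_zero⟩
  rw [adicPow_eq ξ _ n hn, adicPow_eq ξ _ n hn, adicPow_eq ξ _ n hn, map_add, ZMod.val_add,
    ← pow_add, ← pow_eq_pow_mod _ hn]

/-- Evaluation at `ξ` of the reduction modulo `p`, as a ring homomorphism. -/
noncomputable def genEvalReduce (p : ℕ) [Algebra (ZMod p) K] (ξ : muEllInf ℓ K) :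
    AddMonoidAlgebra ℤ ℤ_[ℓ] →+* K :=
  (AddMonoidAlgebra.lift (ZMod p) K ℤ_[ℓ]
    { toFun := fun a => (adicPow ξ a.toAdd : Kˣ)
      map_one' := by rw [toAdd_one, adicPow_zero, Units.val_one]
      map_mul' := fun a b => by rw [toAdd_mul, adicPow_add, Units.val_mul] }).toRingHom.comp
    (AddMonoidAlgebra.mapRingHom ℤ_[ℓ] (Int.castRingHom (ZMod p)))

theorem genEvalReduce_apply (p : ℕ) [Algebra (ZMod p) K] (ξ : muEllInf ℓ K)
    (P : AddMonoidAlgebra ℤ ℤ_[ℓ]) : genEvalReduce p ξ P = genEval ξ (reduceMod p P) := rfl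

theorem genEvalReduce_single (p : ℕ) [Algebra (ZMod p) K] (ξ : muEllInf ℓ K) (a : ℤ_[ℓ]) :
    genEvalReduce p ξ (AddMonoidAlgebra.single a 1) = (adicPow ξ a : Kˣ) := by
  simp [genEvalReduce]

end Eval

/-! ### Values of `f` modulo `p` and the layers of the tower -/

namespace Multigraph

open Finset

variable {X : Multigraph}

/-- Each directed edge is an element of `S` or the inverse of one. -/
theorem Sect.sum_dart [Fintype X.Dart] (σ : X.Sect) [Fintype σ.S] {M : Type*} [AddCommMonoid M]
    (w : X.Dart → M) : ∑ e, w e = ∑ s : σ.S, w s + ∑ s : σ.S, w (X.inv s) := by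
  have hbij : Function.Bijective (Sum.elim (fun s : σ.S => (s : X.Dart)) fun s : σ.S => X.inv s) := by
    constructor
    · rintro (s | s) (t | t) h
      · exact congrArg _ (Subtype.ext h)
      · exact absurd ((show (s : X.Dart) = X.inv t from h) ▸ s.2) (σ.not_inv_mem t.2)
      · exact absurd ((show (t : X.Dart) = X.inv s from h.symm) ▸ t.2) (σ.not_inv_mem s.2)
      · refine congrArg _ (Subtype.ext ?_)
        rw [← X.inv_inv s, ← X.inv_inv t]
        exact congrArg _ h
    · intro e
      by_cases he : e ∈ σ.S
      · exact ⟨.inl ⟨e, he⟩, rfl⟩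
      · exact ⟨.inr ⟨X.inv e, σ.inv_mem he⟩, X.inv_inv e⟩
  rw [← hbij.sum_comp, Fintype.sum_sum_type]
  rfl

theorem Sect.extend_of_mem (σ : X.Sect) {A : Type*} [AddGroup A] (α : σ.S → A) (s : σ.S) :
    σ.extend α s = α s := dif_pos s.2

theorem Sect.map_extend (σ : X.Sect) {A B : Type*} [AddGroup A] [AddGroup B] (f : A →+ B)
    (α : σ.S → A) (e : X.Dart) : σ.extend (fun s => f (α s)) e = f (σ.extend α e) := by
  unfold Sect.extend
  split_ifs with h
  · rfl
  · rw [map_neg]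

variable [Fintype X.V] [DecidableEq X.V] [Fintype X.Dart] {ℓ : ℕ} [Fact ℓ.Prime]

/-- As `α(ē) = -α(e)`, the two sums over `S` in `M(T)` merge into one sum over all darts, so `M(ξ)`
is the Laplacian with weights `ξ ^ α(e)`. -/
theorem genEval_polyF (p : ℕ) {K : Type*} [CommRing K] [Algebra (ZMod p) K] (ξ : muEllInf ℓ K)
    (σ : X.Sect) (α : σ.S → ℤ_[ℓ]) :
    genEval ξ (reduceMod p (X.polyF σ α)) =
      (X.weightedLaplacian fun e => ((adicPow ξ (σ.extend α e) : Kˣ) : K)).det := by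
  rw [← genEvalReduce_apply, polyF, RingHom.map_det]
  congr 1
  ext x y
  have hval : X.valency x = (univ.filter fun e => (X.inc e).1 = x).card := by
    rw [valency, ← Set.ncard_coe_finset]
    congr 1
    ext e
    simp
  have hsum : ∑ e with (X.inc e).1 = x,
      (if (X.inc e).2 = y then ((adicPow ξ (σ.extend α e) : Kˣ) : K) else 0) =
      ∑ e, if X.inc e = (x, y) then ((adicPow ξ (σ.extend α e) : Kˣ) : K) else 0 := by
    rw [Finset.sum_filter]
    refine Finset.sum_congr rfl fun e _ => ?_
    rw [← ite_and]
    simp only [Prod.ext_iff]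
  classical
  simp only [RingHom.mapMatrix_apply, Matrix.map_apply, weightedLaplacian, Matrix.of_apply,
    Finset.sum_sub_distrib, hsum, matrixM, Matrix.sub_apply, map_sub, map_add, map_sum]
  rw [σ.sum_dart]
  congr 1
  · by_cases hxy : x = y
    · subst hxy
      simp [hval]
    · simp [hxy]
  · congr 1
    · refine Finset.sum_congr rfl fun s _ => ?_
      rw [apply_ite (genEvalReduce p ξ), genEvalReduce_single, map_zero, σ.extend_of_mem]
      congr 1
    · refine Finset.sum_congr rfl fun s _ => ?_
      rw [apply_ite (genEvalReduce p ξ), genEvalReduce_single, map_zero, σ.extend_inv,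
        σ.extend_of_mem, X.inc_inv]
      have hswap : (X.inc s).swap = (x, y) ↔ X.inc s = (y, x) := Prod.swap_eq_iff_eq_swap
      simp only [hswap]
      congr 1

/-- The number of spanning trees of a layer is prime to `p` if and only if that of `X` is, and `f`
modulo `p` does not vanish at the non-trivial roots of unity of order dividing `ℓ ^ n`. -/
theorem not_dvd_kappa_layer_iff {p : ℕ} [Fact p.Prime] (hpl : p ≠ ℓ) {K : Type*} [Field K]
    [Algebra (ZMod p) K] [CharP K p] {n : ℕ} {ζ : K} (hζ : IsPrimitiveRoot ζ (ℓ ^ n))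
    [Nonempty X.V] (σ : X.Sect) (α : σ.S → ℤ_[ℓ]) :
    ¬ p ∣ (X.layer σ α n).kappa ↔ ¬ p ∣ X.kappa ∧ ∀ ξ : muEllInf ℓ K, (ξ : Kˣ) ^ ℓ ^ n = 1 →
      (ξ : Kˣ) ≠ 1 → genEval ξ (reduceMod p (X.polyF σ α)) ≠ 0 := by
  have : NeZero (ℓ ^ n) := ⟨pow_ne_zero _ (Fact.out (p := ℓ.Prime)).ne_zero⟩
  have hN : ((ℓ ^ n : ℕ) : K) ≠ 0 := cast_prime_pow_ne_zero hpl n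
  let ψ := AddChar.zmodChar (ℓ ^ n) hζ.pow_eq_one
  have hψ : ψ.IsPrimitive := AddChar.zmodChar_primitive_of_primitive_root _ hζ
  have hkey := X.mul_kappa_derived hN hψ σ fun s => PadicInt.toZModPow n (α s)
  -- For `ξ = ψ c`, the weight `ξ ^ α(e)` is the character value `ψ (α_n(e) * c)`, so `f` at `ξ` is
  -- the determinant of the block at `c`.
  have hdet : ∀ (ξ : muEllInf ℓ K) (c : ZMod (ℓ ^ n)), (ξ : Kˣ) ^ ℓ ^ n = 1 →
      ((ξ : Kˣ) : K) = ψ c → genEval ξ (reduceMod p (X.polyF σ α)) =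
      (X.weightedLaplacian fun e =>
        ψ (σ.extend (fun s => PadicInt.toZModPow n (α s)) e * c)).det := by
    intro ξ c hξ hc
    rw [genEval_polyF]
    congr 2
    ext e
    rw [adicPow_eq ξ _ n hξ, Units.val_pow_eq_pow_val, hc, ← AddChar.map_nsmul_eq_pow,
      nsmul_eq_mul, ZMod.natCast_zmod_val]
    congr 2
    exact (σ.map_extend (PadicInt.toZModPow n : ℤ_[ℓ] →+* ZMod (ℓ ^ n)).toAddMonoidHom α e).symm
  have hψ1 : ∀ c, ψ c = 1 ↔ c = 0 := by
    intro c
    refine ⟨fun h => ?_, fun h => by rw [h, AddChar.map_zero_eq_one]⟩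
    rw [AddChar.zmodChar_apply, hζ.pow_eq_one_iff_dvd] at h
    exact (ZMod.val_eq_zero c).1 (Nat.eq_zero_of_dvd_of_lt h (ZMod.val_lt c))
  rw [← CharP.cast_eq_zero_iff K p, ← CharP.cast_eq_zero_iff K p X.kappa]
  have h1 : ((X.layer σ α n).kappa : K) = 0 ↔
      ((ℓ ^ n : ℕ) : K) * (X.layer σ α n).kappa = 0 := by
    rw [mul_eq_zero, or_iff_right hN]
  rw [h1]
  change ¬ ((ℓ ^ n : ℕ) : K) * (X.derived σ fun s => PadicInt.toZModPow n (α s)).kappa = 0 ↔ _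
  rw [hkey, mul_eq_zero, not_or, Finset.prod_eq_zero_iff]
  refine and_congr_right fun _ => ?_
  push Not
  constructor
  · intro h ξ hξ hξ1
    obtain ⟨i, -, hi⟩ := hζ.eq_pow_of_pow_eq_one
      (show ((ξ : Kˣ) : K) ^ ℓ ^ n = 1 by rw [← Units.val_pow_eq_pow_val, hξ, Units.val_one])
    have hc : ((ξ : Kˣ) : K) = ψ i := by rw [AddChar.zmodChar_apply', hi]
    rw [hdet ξ i hξ hc]
    refine h _ (Finset.mem_erase.2 ⟨fun h0 => hξ1 ?_, mem_univ _⟩)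
    rw [← Units.val_eq_one, hc, h0, AddChar.map_zero_eq_one]
  · intro h c hc
    have hpow : ψ c ^ ℓ ^ n = 1 := by
      rw [← AddChar.map_nsmul_eq_pow, nsmul_eq_mul, ZMod.natCast_self, zero_mul,
        AddChar.map_zero_eq_one]
    let u : Kˣ := Units.ofPowEqOne _ _ hpow (NeZero.ne _)
    have hu : u ^ ℓ ^ n = 1 := Units.pow_ofPowEqOne _ _
    rw [← hdet ⟨u, n, hu⟩ c hu rfl]
    refine h _ hu fun h0 => (Finset.mem_erase.1 hc).1 ((hψ1 c).1 ?_)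
    have := congrArg Units.val h0
    exact this

end Multigraph

/-! ### Roots of unity in `k_∞` -/

/-- A primitive root in the algebraic closure has valuation `1`, and its residue is a root of the `ℓ
^ n`-th cyclotomic polynomial. Because `ℓ ^ n` is nonzero in `k_∞`, such a root is again primitive.
-/
theorem exists_isPrimitiveRoot_kInf {ℓ p : ℕ} [Fact ℓ.Prime] [Fact p.Prime] (hpl : p ≠ ℓ) (n : ℕ) :
    ∃ ζ : kInf ℓ p, IsPrimitiveRoot ζ (ℓ ^ n) := by
  have : NeZero (ℓ ^ n) := ⟨pow_ne_zero _ (Fact.out (p := ℓ.Prime)).ne_zero⟩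
  have hN : ((ℓ ^ n : ℕ) : kInf ℓ p) ≠ 0 := cast_prime_pow_ne_zero hpl n
  have : NeZero ((ℓ ^ n : ℕ) : kInf ℓ p) := ⟨hN⟩
  obtain ⟨z, hz⟩ := HasEnoughRootsOfUnity.exists_primitiveRoot (PadicAlgCl p) (ℓ ^ n)
  let z' : cycField ℓ p := ⟨z, IntermediateField.subset_adjoin _ _ ⟨n, hz.pow_eq_one⟩⟩
  have hz' : z' ∈ cycRing ℓ p := by
    have h1 := congrArg (PadicAlgCl.valued p).v hz.pow_eq_one
    rw [map_pow, map_one] at h1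
    exact (pow_le_one_iff (NeZero.ne (ℓ ^ n))).1 h1.le
  have hz'' : IsPrimitiveRoot (⟨z', hz'⟩ : cycRing ℓ p) (ℓ ^ n) := by
    refine IsPrimitiveRoot.of_map_of_injective
      (f := (algebraMap (cycField ℓ p) (PadicAlgCl p)).comp (cycRing ℓ p).subtype) hz ?_
    exact (algebraMap (cycField ℓ p) (PadicAlgCl p)).injective.comp Subtype.val_injective
  refine ⟨IsLocalRing.residue _ ⟨z', hz'⟩, ?_⟩
  rw [← Polynomial.isRoot_cyclotomic_iff, ← Polynomial.map_cyclotomic _ (IsLocalRing.residue _)]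
  exact (hz''.isRoot_cyclotomic (NeZero.pos _)).map

theorem mainTheorem3 {ℓ p : ℕ} [Fact ℓ.Prime] [Fact p.Prime] (hpl : p ≠ ℓ)
    (X : Multigraph) [Fintype X.V] [DecidableEq X.V] [Fintype X.Dart]
    (hconn : X.Connected) (hval : ∀ x, X.valency x ≠ 1) (hchi : X.eulerChar ≠ 0)
    (σ : X.Sect) (α : σ.S → ℤ_[ℓ]) (htower : ∀ n, (X.layer σ α n).Connected)
    (g : AddMonoidAlgebra ℤ ℤ_[ℓ])
    (hfg : X.polyF σ α = p ^ (muInv p (X.polyF σ α)).toNat * g) (hg : muInv p g = 0)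
    (hmu : muInv p (X.polyF σ α) = 0) :
    (∀ n ≥ 1, ¬ p ∣ (X.layer σ α n).kappa) ↔
      (¬ p ∣ X.kappa ∧
        ∀ ξ : muEllInf ℓ (kInf ℓ p), (ξ : (kInf ℓ p)ˣ) ≠ 1 → genEval ξ (reduceMod p g) ≠ 0) := by
  have : Nonempty X.V := hconn.1
  have hfg' : g = X.polyF σ α := by
    rw [hfg, hmu, ENat.toNat_zero, pow_zero, one_mul]
  subst hfg'
  have key := fun n => Multigraph.not_dvd_kappa_layer_iff hpl
    (exists_isPrimitiveRoot_kInf hpl n).choose_spec σ α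
  constructor
  · intro h
    refine ⟨((key 1).1 (h 1 le_rfl)).1, fun ξ hξ1 => ?_⟩
    obtain ⟨n, hn⟩ := ξ.2
    -- The exponent `n` may be `0`, while the hypothesis concerns layers from `1` on; the order of
    -- `ξ` also divides `ℓ ^ (n + 1)`.
    refine ((key (n + 1)).1 (h _ (Nat.le_add_left _ _))).2 ξ ?_ hξ1
    rw [pow_succ, pow_mul, hn, one_pow]
  · rintro ⟨h1, h2⟩ n -
    exact (key n).2 ⟨h1, fun ξ _ => h2 ξ⟩
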